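/- Let $H$ be a real separable Hilbert space with a fixed countable orthonormal basis $(e_i)_{i\in I}$, let $(\Omega,\mathsf P)$ be a standard probability space and let $(\mathcal T,\mu)$ be a standard Borel space with a $\sigma$-finite positive measure. A generalized $H$-valued function on $(\mathcal T,\mu)$ is a continuous linear operator $Y:H\to L^0(\mathcal T,\mu)$, $\xi\mapsto\langle Y,\xi\rangle$, where $L^0$ carries the topology of convergence in measure with respect to a finite measure equivalent to $\mu$; its value $Y(t)$ is identified with the family of coordinates $(\langle Y(t),e_i\rangle)_{i}\in\mathbb R^{I}$, defined for $\mu$-almost every $t$, and vectors $\xi\in H$ are likewise identified with $(\langle \xi,e_i\rangle)_i$. Laws are laws of coordinates on the product space $\mathbb R^I$. Let $X$ be a standard Gaussian in $H$, i.e. a generalized $H$-valued function on $(\Omega,\mathsf P)$ such that $\langle X,\xi\rangle\sim N(0,\|\xi\|^2)$ for all $\xi\in H$, and let $Y$ be a generalized $H$-valued function on $(\mathcal T,\mu)$. A Gaussian multiplicative chaos (GMC) over $(X,Y)$ is a random positive finite measure $M=M(X,dt)$ on $\mathcal T$, measurable with respect to $X$, whose expectation $\mathsf E M[A]:=\mathsf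 E(M[A])$ satisfies $\mathsf E M\ll\mu$, and such that for every $\xi\in H$, almost surely, $$M(X+\xi,dt)=e^{\langle Y(t),\xi\rangle}M(X,dt).$$ It is subcritical if $\mathsf E M$ is $\sigma$-finite. $Y$ is a randomized shift if $\mathrm{Law}_{\mathsf P\otimes\mu}[X+Y]\ll\mathrm{Law}_{\mathsf P}X$, where $X+Y$ denotes $(\omega,t)\mapsto X(\omega)+Y(t)$. Theorem. 1. If $\mu$ is finite, then there exists a subcritical GMC $M$ over $(X,Y)$ with expectation $\mathsf E M=\mu$ if and only if $Y$ is a randomized shift. 2. For general $\sigma$-finite $\mu$, there exists a subcritical GMC $M$ over $(X,Y)$ with expectation $\mathsf E M=\mu$ if and only if $Y$ is a randomized shift and the measure $\mathrm{Law}_{\mathsf P\otimes\mu}[X+Y]$ is $\sigma$-finite (the latter being automatic if $\mu$ is finite). 3. In either case, for every subcritical GMC $M$ over $(X,Y)$ with $\mathsf E M=\mu$, the Peyrière measure $\mathsf Q(d\omega,dt):=\mathsf P(d\omega)M(X(\omega),dt)$ on $\Omega\times\mathcal T$ satisfies $$\mathrm{Law}_{\mathsf Q}[X,t]=\mathrm{Law}_{\mathsf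 P\otimes\mu}[X+Y(t),t].$$ -/

import Mathlib

open MeasureTheory ProbabilityTheory Filter Topology
open scoped ENNReal NNReal

noncomputable section

/-- A generalized `H`-valued function on a measure space `(T, μ)`: a linear operator
`Y : H → L⁰(T, μ)` that is continuous for the topology of convergence in measure. For a
`σ`-finite `μ` this topology is the one of any equivalent finite measure, here
`μ.toFinite`. -/
structure GenFun (H : Type*) [NormedAddCommGroup H] [InnerProductSpace ℝ H]
    {T : Type*} [MeasurableSpace T] (μ : Measure T) [SFinite μ] where
  /-- The pairing `ξ ↦ ⟨Y, ξ⟩`, an equivalence class of measurable functions. -/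
  pair : H →ₗ[ℝ] (T →ₘ[μ] ℝ)
  continuous_pair : ∀ ξ : H,
    TendstoInMeasure μ.toFinite (fun η : H => (pair η : T → ℝ)) (𝓝 ξ) (pair ξ : T → ℝ)

namespace GenFun

variable {H : Type*} [NormedAddCommGroup H] [InnerProductSpace ℝ H]
  {T : Type*} [MeasurableSpace T] {μ : Measure T} [SFinite μ]
  {ι : Type*}

/-- The value `Y(t) ∈ ℝ^ι`: the sequence of coordinates `⟨Y(t), e_i⟩` in an orthonormal
basis. -/
def coords (b : HilbertBasis ι ℝ H) (Y : GenFun H μ) (t : T) : ι → ℝ :=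
  fun i => Y.pair (b i) t

theorem measurable_coords (b : HilbertBasis ι ℝ H) (Y : GenFun H μ) :
    Measurable (Y.coords b) :=
  measurable_pi_lambda _ fun i => (Y.pair (b i)).stronglyMeasurable.measurable

/-- `X` is standard Gaussian in `H`: every `⟨X, ξ⟩` is a centered Gaussian random variable of
variance `‖ξ‖²`. -/
def IsStandardGaussian (X : GenFun H μ) : Prop :=
  ∀ ξ : H, μ.map (X.pair ξ) = gaussianReal 0 (‖ξ‖₊ ^ 2)

end GenFun

/-- The coordinates of a true vector `ξ ∈ H`, as an element of `ℝ^ι`. -/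
def vecCoords {H : Type*} [NormedAddCommGroup H] [InnerProductSpace ℝ H] {ι : Type*}
    (b : HilbertBasis ι ℝ H) (ξ : H) : ι → ℝ :=
  fun i => inner ℝ (b i) ξ

section GMC

variable {H : Type*} [NormedAddCommGroup H] [InnerProductSpace ℝ H]
  {ι : Type*} (b : HilbertBasis ι ℝ H)
  {Ω : Type*} [MeasurableSpace Ω] {P : Measure Ω} [SFinite P]
  {T : Type*} [MeasurableSpace T] {μ : Measure T} [SFinite μ]

/-- `Law_P X`, the joint distribution of the coordinates of `X`. -/
def lawX (X : GenFun H P) : Measure (ι → ℝ) := P.map (X.coords b)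

/-- `Law_{P ⊗ μ} [X + Y]`. -/
def lawShift (X : GenFun H P) (Y : GenFun H μ) : Measure (ι → ℝ) :=
  (P.prod μ).map fun p : Ω × T => X.coords b p.1 + Y.coords b p.2

/-- `Law_{P ⊗ μ} [X + Y(t), t]`. -/
def lawShiftPoint (X : GenFun H P) (Y : GenFun H μ) : Measure ((ι → ℝ) × T) :=
  (P.prod μ).map fun p : Ω × T => (X.coords b p.1 + Y.coords b p.2, p.2)

/-- `Y` is a randomized shift of `X`. -/
def IsRandomizedShift (X : GenFun H P) (Y : GenFun H μ) : Prop :=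
  lawShift b X Y ≪ lawX b X

/-- The expectation `E M` of the random measure `ω ↦ M(X(ω), dt)`,
so that `(E M)[A] = E (M(X)[A])`. -/
def expectationMeasure (X : GenFun H P) (M : Kernel (ι → ℝ) T) : Measure T :=
  P.bind fun ω => M (X.coords b ω)

/-- The random measure `ω ↦ M(X(ω), dt)` is a Gaussian multiplicative chaos over `(X, Y)`.
Measurability with respect to `X` is expressed by giving `M` as a measurable function `M(x, dt)`
of the value `x` of `X`. -/
structure IsGMC (X : GenFun H P) (Y : GenFun H μ) (M : Kernel (ι → ℝ) T) : Prop where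
  finite : ∀ x, IsFiniteMeasure (M x)
  absolutelyContinuous : expectationMeasure b X M ≪ μ
  shift : ∀ ξ : H, ∀ᵐ ω ∂P, M (X.coords b ω + vecCoords b ξ) =
    (M (X.coords b ω)).withDensity fun t => ENNReal.ofReal (Real.exp (Y.pair ξ t))

/-- A GMC is subcritical if its expectation is `σ`-finite. -/
structure IsSubcriticalGMC (X : GenFun H P) (Y : GenFun H μ) (M : Kernel (ι → ℝ) T) : Prop
    extends IsGMC b X Y M where
  sigmaFinite : SigmaFinite (expectationMeasure b X M)

/-- The Peyrière measure `Q(dω, dt) = P(dω) M(X(ω), dt)`. -/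
def peyriere (X : GenFun H P) (M : Kernel (ι → ℝ) T) : Measure (Ω × T) :=
  P ⊗ₘ M.comap (X.coords b) (X.measurable_coords b)

/-- `Law_Q [X, t]` under the Peyrière measure `Q`. -/
def lawPeyriere (X : GenFun H P) (M : Kernel (ι → ℝ) T) : Measure ((ι → ℝ) × T) :=
  (peyriere b X M).map fun p : Ω × T => (X.coords b p.1, p.2)

/-- A kernel whose values are finite measures is `s`-finite. -/
theorem isSFiniteKernel_of_forall_finite {α β : Type*} [MeasurableSpace α] [MeasurableSpace β]
    (κ : Kernel α β) (h : ∀ x, IsFiniteMeasure (κ x)) : IsSFiniteKernel κ := by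
  classical
  have hm : Measurable fun x => κ x Set.univ := κ.measurable_coe MeasurableSet.univ
  have hs : ∀ n : ℕ, MeasurableSet {x | ⌊(κ x Set.univ).toReal⌋₊ = n} := fun n =>
    (Nat.measurable_floor.comp hm.ennreal_toReal) (measurableSet_singleton n)
  let κs : ℕ → Kernel α β := fun n => Kernel.piecewise (hs n) κ 0
  have hfin : ∀ n, IsFiniteKernel (κs n) := fun n => by
    refine ⟨⟨ENNReal.ofReal (n + 1), ENNReal.ofReal_lt_top, fun x => ?_⟩⟩
    by_cases hx : ⌊(κ x Set.univ).toReal⌋₊ = n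
    · have h1 : κs n x = κ x := by
        simp only [κs, Kernel.piecewise_apply, Set.mem_ofPred_eq, if_pos hx]
      rw [h1]
      have := h x
      rw [ENNReal.le_ofReal_iff_toReal_le (measure_ne_top _ _) (by positivity)]
      have := Nat.lt_floor_add_one (κ x Set.univ).toReal
      rw [hx] at this
      exact this.le
    · have h1 : κs n x = 0 := by
        simp [κs, Kernel.piecewise_apply, hx]
      rw [h1]; simp
  have hsum : κ = Kernel.sum κs := by
    ext x s hsx
    rw [Kernel.sum_apply' _ _ hsx, tsum_eq_single ⌊(κ x Set.univ).toReal⌋₊]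
    · simp [κs, Kernel.piecewise_apply]
    · intro n hn
      simp [κs, Kernel.piecewise_apply, hn.symm]
  rw [hsum]
  exact Kernel.isSFiniteKernel_sum

/-- For a finite random measure, the Peyrière measure is given by the expected formula. -/
theorem peyriere_apply_prod (X : GenFun H P) (M : Kernel (ι → ℝ) T)
    (h : ∀ x, IsFiniteMeasure (M x)) {A : Set Ω} {B : Set T}
    (hA : MeasurableSet A) (hB : MeasurableSet B) :
    peyriere b X M (A ×ˢ B) = ∫⁻ ω in A, M (X.coords b ω) B ∂P := by
  have := isSFiniteKernel_of_forall_finite M h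
  rw [peyriere, Measure.compProd_apply_prod hA hB]
  simp [Kernel.comap_apply]

end GMC

end

/-!
Everything rests on the Cameron–Martin formula: for a measurable `G ≥ 0` on `ℝ^ι`,
`E G(X + ξ) = E exp(⟨X, ξ⟩ - ‖ξ‖² / 2) G(X)`. It is proved by comparing Laplace transforms
(`GenFun.IsStandardGaussian.map_add_vecCoords`), which avoids any explicit product structure of
the law of `X`.

Given a chaos `M` with expectation `μ`, let `η` be a finite combination of basis vectors and `A` a
set of points. The Cameron–Martin formula and the shift property of `M` give
`E [exp ⟨X, η⟩ M(X, A)] = exp(‖η‖² / 2) ∫_A exp ⟨Y(t), η⟩ μ(dt)`,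
which is also `∫_A E exp ⟨X + Y(t), η⟩ μ(dt)`. Laplace transforms determine measures where they are
finite, so the law of `(X, t)` under the Peyrière measure is that of `(X + Y(t), t)` under `P ⊗ μ`
(`lawPeyriere_eq_lawShiftPoint`). Its first marginal, the law of `X + Y`, therefore has the finite
density `M(x, T)` with respect to the law of `X`: it is absolutely continuous and `σ`-finite
(`isRandomizedShift_and_sigmaFinite`).

Conversely, if the law of `X + Y` is `σ`-finite and absolutely continuous, the law of
`(X + Y(t), t)` disintegrates over the law of `X` as a kernel `M` with finite values
(`exists_kernel_compProd_eq`). The Cameron–Martin formula, applied to `X` for each fixed `t`, shows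
that `M(x + ξ, dt)` and `exp ⟨Y(t), ξ⟩ M(x, dt)` have the same integrals
(`shift_of_compProd_eq_lawShiftPoint`). For this the density `exp(⟨X, ξ⟩ - ‖ξ‖² / 2)` has to be
written as a function on `ℝ^ι` that can be evaluated both at `X` and at `X + Y`
(`GenFun.exists_measurable_exp_pair`).
-/

/-! ### Uniqueness of the Laplace transform -/

theorem ext_of_lintegral_exp_real {m₁ m₂ : Measure ℝ} [IsFiniteMeasure m₁] [IsFiniteMeasure m₂]
    (hfin : ∀ s : ℝ, ∫⁻ x, ENNReal.ofReal (Real.exp (s * x)) ∂m₁ ≠ ∞)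
    (h : ∀ s : ℝ, ∫⁻ x, ENNReal.ofReal (Real.exp (s * x)) ∂m₁ =
      ∫⁻ x, ENNReal.ofReal (Real.exp (s * x)) ∂m₂) : m₁ = m₂ := by
  have hmgf : mgf id m₁ = mgf id m₂ := by
    ext s
    simp only [mgf, id]
    rw [integral_eq_lintegral_of_nonneg_ae (ae_of_all _ fun x => (Real.exp_pos _).le)
        (by fun_prop), integral_eq_lintegral_of_nonneg_ae
        (ae_of_all _ fun x => (Real.exp_pos _).le) (by fun_prop), h s]
  have huniv : m₁ Set.univ = m₂ Set.univ := by simpa using h 0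
  have hint : integrableExpSet id m₁ = Set.univ := by
    ext s
    simp only [integrableExpSet, id, Set.mem_ofPred_eq, Set.mem_univ, iff_true]
    refine ⟨by fun_prop, ?_⟩
    rw [hasFiniteIntegral_iff_ofReal (ae_of_all _ fun x => (Real.exp_pos _).le)]
    exact (hfin s).lt_top
  refine Measure.ext_of_complexMGF_id_eq (funext fun z => ?_)
  refine eqOn_complexMGF_of_mgf' hmgf ?_ (by simp [hint])
  rw [← Measure.measure_univ_eq_zero, huniv, Measure.measure_univ_eq_zero]

/-- A Cramér–Wold argument reduces uniqueness of the Laplace transform on `ℝ^J` to that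
on the line. -/
theorem ext_of_lintegral_exp_pi {J : Type*} [Fintype J] {m₁ m₂ : Measure (J → ℝ)}
    [IsFiniteMeasure m₁] [IsFiniteMeasure m₂]
    (hfin : ∀ c : J → ℝ, ∫⁻ x, ENNReal.ofReal (Real.exp (∑ j, c j * x j)) ∂m₁ ≠ ∞)
    (h : ∀ c : J → ℝ, ∫⁻ x, ENNReal.ofReal (Real.exp (∑ j, c j * x j)) ∂m₁ =
      ∫⁻ x, ENNReal.ofReal (Real.exp (∑ j, c j * x j)) ∂m₂) : m₁ = m₂ := by
  classical
  refine Measure.ext_of_charFunDual (funext fun L => ?_)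
  have hL : ∀ (s : ℝ) (x : J → ℝ),
      s * L x = ∑ j, (s * L (Pi.single j 1)) * x j := fun s x => by
    conv_lhs => rw [pi_eq_sum_univ' x, map_sum, Finset.mul_sum]
    refine Finset.sum_congr rfl fun j _ => ?_
    rw [map_smul, smul_eq_mul]
    ring
  rw [charFunDual_eq_charFun_map_one, charFunDual_eq_charFun_map_one]
  congr 1
  have hm : ∀ (m : Measure (J → ℝ)) (s : ℝ),
      ∫⁻ x, ENNReal.ofReal (Real.exp (s * x)) ∂(m.map L) =
        ∫⁻ x, ENNReal.ofReal (Real.exp (∑ j, (s * L (Pi.single j 1)) * x j)) ∂m := fun m s => by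
    rw [lintegral_map (by fun_prop) (by fun_prop)]
    exact lintegral_congr fun x => by rw [hL]
  exact ext_of_lintegral_exp_real (fun s => by rw [hm]; exact hfin _)
    (fun s => by rw [hm, hm]; exact h _)

theorem ext_of_map_restrict {ι : Type*} {m₁ m₂ : Measure (ι → ℝ)} [IsFiniteMeasure m₁]
    (h : ∀ J : Finset ι, m₁.map J.restrict = m₂.map J.restrict) : m₁ = m₂ :=
  IsProjectiveLimit.unique (P := fun J => m₁.map J.restrict) (fun _ => rfl) fun J => (h J).symm

/-! ### Linearity of generalized functions and the Cameron–Martin formula -/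

namespace GenFun

variable {H : Type*} [NormedAddCommGroup H] [InnerProductSpace ℝ H]
  {T : Type*} [MeasurableSpace T] {μ : Measure T} [SFinite μ]

@[fun_prop]
theorem measurable_pair (Y : GenFun H μ) (ξ : H) : Measurable (Y.pair ξ : T → ℝ) :=
  (Y.pair ξ).stronglyMeasurable.measurable

theorem pair_add_ae (Y : GenFun H μ) (ξ η : H) :
    (Y.pair (ξ + η) : T → ℝ) =ᵐ[μ] fun t => Y.pair ξ t + Y.pair η t := by
  rw [map_add]
  exact AEEqFun.coeFn_add _ _

theorem pair_sum_ae {κ : Type*} (Y : GenFun H μ) (s : Finset κ) (c : κ → ℝ) (v : κ → H) :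
    (Y.pair (∑ k ∈ s, c k • v k) : T → ℝ) =ᵐ[μ] fun t => ∑ k ∈ s, c k * Y.pair (v k) t := by
  classical
  induction s using Finset.induction_on with
  | empty =>
    simp only [Finset.sum_empty, map_zero]
    exact AEEqFun.coeFn_zero
  | insert a s ha ih =>
    simp only [Finset.sum_insert ha]
    have hsm : (Y.pair (c a • v a) : T → ℝ) =ᵐ[μ] fun t => c a * Y.pair (v a) t := by
      rw [map_smul]
      exact AEEqFun.coeFn_smul _ _
    filter_upwards [Y.pair_add_ae (c a • v a) (∑ k ∈ s, c k • v k), hsm, ih] with t h1 h2 h3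
    rw [h1, h2, h3]

end GenFun

section

variable {H : Type*} [NormedAddCommGroup H] [InnerProductSpace ℝ H]
  {ι : Type*} (b : HilbertBasis ι ℝ H)
  {Ω : Type*} [MeasurableSpace Ω] {P : Measure Ω} [IsProbabilityMeasure P]
  {T : Type*} [MeasurableSpace T] {μ : Measure T}

theorem GenFun.IsStandardGaussian.lintegral_exp {X : GenFun H P} (hX : X.IsStandardGaussian)
    (ξ : H) :
    ∫⁻ ω, ENNReal.ofReal (Real.exp (X.pair ξ ω)) ∂P =
      ENNReal.ofReal (Real.exp (‖ξ‖ ^ 2 / 2)) := by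
  have h := mgf_gaussianReal (hX ξ) 1
  have hi : Integrable (fun ω => Real.exp (X.pair ξ ω)) P := by
    have := integrable_exp_mul_gaussianReal (μ := 0) (v := ‖ξ‖₊ ^ 2) 1
    rw [← hX ξ, integrable_map_measure (by fun_prop) (by fun_prop)] at this
    simpa [Function.comp_def] using this
  rw [← ofReal_integral_eq_lintegral_ofReal hi (ae_of_all _ fun x => (Real.exp_pos _).le)]
  simp only [mgf, one_mul] at h
  rw [h]
  simp

theorem GenFun.IsStandardGaussian.lintegral_exp_sub {X : GenFun H P} (hX : X.IsStandardGaussian)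
    (ξ η : H) :
    ∫⁻ ω, ENNReal.ofReal (Real.exp (X.pair ξ ω - ‖ξ‖ ^ 2 / 2)) *
        ENNReal.ofReal (Real.exp (X.pair η ω)) ∂P =
      ENNReal.ofReal (Real.exp (‖η‖ ^ 2 / 2 + inner ℝ ξ η)) := by
  have h : ∀ᵐ ω ∂P, ENNReal.ofReal (Real.exp (X.pair ξ ω - ‖ξ‖ ^ 2 / 2)) *
        ENNReal.ofReal (Real.exp (X.pair η ω)) =
      ENNReal.ofReal (Real.exp (-(‖ξ‖ ^ 2 / 2))) *
        ENNReal.ofReal (Real.exp (X.pair (ξ + η) ω)) := by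
    filter_upwards [X.pair_add_ae ξ η] with ω hω
    rw [hω, ← ENNReal.ofReal_mul (Real.exp_pos _).le, ← ENNReal.ofReal_mul (Real.exp_pos _).le,
      ← Real.exp_add, ← Real.exp_add]
    congr 2; ring
  rw [lintegral_congr_ae h, lintegral_const_mul _ (by fun_prop), hX.lintegral_exp,
    ← ENNReal.ofReal_mul (Real.exp_pos _).le, ← Real.exp_add, norm_add_sq_real]
  congr 2; ring

/-- The Cameron–Martin formula: shifting a standard Gaussian by `ξ` multiplies its law by the
exponential density `exp (⟨X, ξ⟩ - ‖ξ‖² / 2)`. -/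
theorem GenFun.IsStandardGaussian.map_add_vecCoords {X : GenFun H P} (hX : X.IsStandardGaussian)
    (ξ : H) :
    P.map (fun ω => X.coords b ω + vecCoords b ξ) =
      (P.withDensity fun ω => ENNReal.ofReal (Real.exp (X.pair ξ ω - ‖ξ‖ ^ 2 / 2))).map
        (X.coords b) := by
  have hXm := X.measurable_coords b
  have hd : Measurable fun ω => ENNReal.ofReal (Real.exp (X.pair ξ ω - ‖ξ‖ ^ 2 / 2)) := by fun_prop
  have : IsFiniteMeasure
      (P.withDensity fun ω => ENNReal.ofReal (Real.exp (X.pair ξ ω - ‖ξ‖ ^ 2 / 2))) := by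
    refine isFiniteMeasure_withDensity ?_
    have h := hX.lintegral_exp_sub ξ 0
    simp at h
    simp [h]
  refine ext_of_map_restrict fun J => ?_
  have hr : Measurable (J.restrict : (ι → ℝ) → (J → ℝ)) := by fun_prop
  rw [Measure.map_map hr (by fun_prop), Measure.map_map hr hXm]
  -- Both Laplace transforms at `c` equal `exp (‖η‖² / 2 + ⟨ξ, η⟩)` with `η = ∑ c j • b j`.
  have hsum : ∀ c : J → ℝ, ∀ᵐ ω ∂P, ∑ j, c j * X.coords b ω j =
      X.pair (∑ j, c j • b j) ω := fun c => by
    filter_upwards [X.pair_sum_ae Finset.univ c fun j => b j] with ω hω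
    rw [hω]; rfl
  have h1 : ∀ c : J → ℝ, ∫⁻ x, ENNReal.ofReal (Real.exp (∑ j, c j * x j))
        ∂(P.map (J.restrict ∘ fun ω => X.coords b ω + vecCoords b ξ)) =
      ENNReal.ofReal (Real.exp (‖∑ j, c j • b j‖ ^ 2 / 2 + inner ℝ ξ (∑ j, c j • b j))) :=
    fun c => by
    rw [lintegral_map (by fun_prop) (by fun_prop)]
    have he : ∀ᵐ ω ∂P, ENNReal.ofReal (Real.exp (∑ j, c j *
          (J.restrict ∘ fun ω => X.coords b ω + vecCoords b ξ) ω j)) =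
        ENNReal.ofReal (Real.exp (inner ℝ ξ (∑ j, c j • b j))) *
          ENNReal.ofReal (Real.exp (X.pair (∑ j, c j • b j) ω)) := by
      filter_upwards [hsum c] with ω hω
      rw [← hω, ← ENNReal.ofReal_mul (Real.exp_pos _).le, ← Real.exp_add, inner_sum,
        ← Finset.sum_add_distrib]
      congr 2
      refine Finset.sum_congr rfl fun j _ => ?_
      simp only [Function.comp_apply, Finset.restrict, Pi.add_apply, vecCoords,
        real_inner_smul_right, real_inner_comm (b j) ξ]
      ring
    rw [lintegral_congr_ae he, lintegral_const_mul _ (by fun_prop), hX.lintegral_exp,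
      ← ENNReal.ofReal_mul (Real.exp_pos _).le, ← Real.exp_add, add_comm]
  refine ext_of_lintegral_exp_pi (fun c => by rw [h1]; exact ENNReal.ofReal_ne_top) fun c => ?_
  rw [h1, lintegral_map (by fun_prop) (hr.comp hXm),
    lintegral_withDensity_eq_lintegral_mul _ hd (by fun_prop), ← hX.lintegral_exp_sub]
  refine lintegral_congr_ae ?_
  filter_upwards [hsum c] with ω hω
  rw [← hω]
  rfl

/-- The Cameron–Martin formula for integrals of functions of the coordinates. -/
theorem GenFun.IsStandardGaussian.lintegral_comp_add {X : GenFun H P} (hX : X.IsStandardGaussian)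
    (ξ : H) {G : (ι → ℝ) → ℝ≥0∞} (hG : Measurable G) :
    ∫⁻ ω, G (X.coords b ω + vecCoords b ξ) ∂P =
      ∫⁻ ω, ENNReal.ofReal (Real.exp (X.pair ξ ω - ‖ξ‖ ^ 2 / 2)) * G (X.coords b ω) ∂P := by
  have hXm := X.measurable_coords b
  have h := congrArg (fun m => ∫⁻ x, G x ∂m) (hX.map_add_vecCoords b ξ)
  rw [lintegral_map hG (by fun_prop), lintegral_map hG hXm] at h
  exact h.trans (lintegral_withDensity_eq_lintegral_mul _ (by fun_prop) (hG.comp hXm))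

end

/-! ### The law of the Peyrière measure -/

section

variable {H : Type*} [NormedAddCommGroup H] [InnerProductSpace ℝ H]
  {ι : Type*} (b : HilbertBasis ι ℝ H)
  {Ω : Type*} [MeasurableSpace Ω] {P : Measure Ω} [IsProbabilityMeasure P]
  {T : Type*} [MeasurableSpace T] {μ : Measure T}

theorem measurable_coords_add_coords [SFinite μ] (X : GenFun H P) (Y : GenFun H μ) :
    Measurable fun p : Ω × T => X.coords b p.1 + Y.coords b p.2 :=
  ((X.measurable_coords b).comp measurable_fst).add ((Y.measurable_coords b).comp measurable_snd)

theorem measurable_coords_prodMk (X : GenFun H P) :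
    Measurable fun p : Ω × T => (X.coords b p.1, p.2) :=
  ((X.measurable_coords b).comp measurable_fst).prodMk measurable_snd

theorem measurable_coords_add_coords_prodMk [SFinite μ] (X : GenFun H P) (Y : GenFun H μ) :
    Measurable fun p : Ω × T => (X.coords b p.1 + Y.coords b p.2, p.2) :=
  (measurable_coords_add_coords b X Y).prodMk measurable_snd

theorem expectationMeasure_apply (X : GenFun H P) (M : Kernel (ι → ℝ) T) {A : Set T}
    (hA : MeasurableSet A) :
    expectationMeasure b X M A = ∫⁻ ω, M (X.coords b ω) A ∂P :=
  Measure.bind_apply hA (M.measurable.comp (X.measurable_coords b)).aemeasurable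

theorem lintegral_expectationMeasure (X : GenFun H P) (M : Kernel (ι → ℝ) T) {f : T → ℝ≥0∞}
    (hf : Measurable f) :
    ∫⁻ t, f t ∂(expectationMeasure b X M) = ∫⁻ ω, ∫⁻ t, f t ∂(M (X.coords b ω)) ∂P :=
  Measure.lintegral_bind (M.measurable.comp (X.measurable_coords b)).aemeasurable hf.aemeasurable

theorem lawPeyriere_apply_prod (X : GenFun H P) {M : Kernel (ι → ℝ) T}
    (hM : ∀ x, IsFiniteMeasure (M x)) {B : Set (ι → ℝ)} {A : Set T}
    (hB : MeasurableSet B) (hA : MeasurableSet A) :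
    lawPeyriere b X M (B ×ˢ A) = ∫⁻ ω in X.coords b ⁻¹' B, M (X.coords b ω) A ∂P := by
  have hX := X.measurable_coords b
  rw [lawPeyriere, Measure.map_apply (measurable_coords_prodMk b X) (hB.prod hA)]
  exact peyriere_apply_prod b X M hM (hX hB) hA

theorem lawPeyriere_univ_prod (X : GenFun H P) {M : Kernel (ι → ℝ) T}
    (hM : ∀ x, IsFiniteMeasure (M x)) {A : Set T} (hA : MeasurableSet A) :
    lawPeyriere b X M (Set.univ ×ˢ A) = expectationMeasure b X M A := by
  rw [lawPeyriere_apply_prod b X hM MeasurableSet.univ hA, expectationMeasure_apply b X M hA]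
  simp

theorem lawShiftPoint_univ_prod [SFinite μ] (X : GenFun H P) (Y : GenFun H μ) {A : Set T}
    (hA : MeasurableSet A) : lawShiftPoint b X Y (Set.univ ×ˢ A) = μ A := by
  rw [lawShiftPoint, Measure.map_apply
    (measurable_coords_add_coords_prodMk b X Y) (MeasurableSet.univ.prod hA)]
  have : (fun p : Ω × T => (X.coords b p.1 + Y.coords b p.2, p.2)) ⁻¹' Set.univ ×ˢ A =
      Set.univ ×ˢ A := by ext; simp
  rw [this, Measure.prod_prod]
  simp

theorem lawShiftPoint_map_fst [SFinite μ] (X : GenFun H P) (Y : GenFun H μ) :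
    (lawShiftPoint b X Y).map Prod.fst = lawShift b X Y := by
  rw [lawShiftPoint, Measure.map_map measurable_fst
    (measurable_coords_add_coords_prodMk b X Y)]
  rfl

/-- The Cameron–Martin formula and the shift property of `M` determine the Laplace transform of
`X` under the Peyrière measure, over each set of points `t`. -/
theorem setLIntegral_exp_lawPeyriere [SFinite μ] {X : GenFun H P} (hX : X.IsStandardGaussian)
    {Y : GenFun H μ} {M : Kernel (ι → ℝ) T} (hM : IsGMC b X Y M)
    (hE : expectationMeasure b X M = μ) {J : Finset ι} (c : J → ℝ) {A : Set T}
    (hA : MeasurableSet A) :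
    ∫⁻ p in Set.univ ×ˢ A, ENNReal.ofReal (Real.exp (∑ j, c j * p.1 j)) ∂(lawPeyriere b X M) =
      ENNReal.ofReal (Real.exp (‖∑ j, c j • b j‖ ^ 2 / 2)) *
        ∫⁻ t in A, ENNReal.ofReal (Real.exp (Y.pair (∑ j, c j • b j) t)) ∂μ := by
  have hXm := X.measurable_coords b
  have := isSFiniteKernel_of_forall_finite M hM.finite
  set η : H := ∑ j, c j • b j with hη
  have hMA : Measurable fun x => M x A := M.measurable_coe hA
  have hMX : Measurable fun ω => M (X.coords b ω) A := hMA.comp hXm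
  have hpre : (fun p : Ω × T => (X.coords b p.1, p.2)) ⁻¹' (Set.univ ×ˢ A) = Set.univ ×ˢ A := by
    ext; simp
  calc
    _ = ∫⁻ ω, ENNReal.ofReal (Real.exp (∑ j, c j * X.coords b ω j)) * M (X.coords b ω) A ∂P := by
      rw [lawPeyriere, setLIntegral_map (MeasurableSet.univ.prod hA) (by fun_prop)
        (measurable_coords_prodMk b X), hpre, peyriere,
        Measure.setLIntegral_compProd (by fun_prop) MeasurableSet.univ hA, Measure.restrict_univ]
      refine lintegral_congr fun ω => ?_
      simp [Kernel.comap_apply]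
    _ = ∫⁻ ω, ENNReal.ofReal (Real.exp (‖η‖ ^ 2 / 2)) *
          (ENNReal.ofReal (Real.exp (X.pair η ω - ‖η‖ ^ 2 / 2)) * M (X.coords b ω) A) ∂P := by
      refine lintegral_congr_ae ?_
      filter_upwards [X.pair_sum_ae Finset.univ c fun j => b j] with ω hω
      rw [← mul_assoc, ← ENNReal.ofReal_mul (Real.exp_pos _).le, ← Real.exp_add, hη, hω]
      simp [GenFun.coords]
    _ = ENNReal.ofReal (Real.exp (‖η‖ ^ 2 / 2)) *
          ∫⁻ ω, M (X.coords b ω + vecCoords b η) A ∂P := by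
      rw [lintegral_const_mul _ (by fun_prop),
        hX.lintegral_comp_add b η hMA]
    _ = ENNReal.ofReal (Real.exp (‖η‖ ^ 2 / 2)) *
          ∫⁻ ω, ∫⁻ t, A.indicator (fun t => ENNReal.ofReal (Real.exp (Y.pair η t))) t
            ∂(M (X.coords b ω)) ∂P := by
      congr 1
      refine lintegral_congr_ae ?_
      filter_upwards [hM.shift η] with ω hω
      rw [hω, withDensity_apply _ hA, lintegral_indicator hA]
    _ = _ := by
      rw [← lintegral_expectationMeasure b X M (.indicator (by fun_prop) hA), hE,
        lintegral_indicator hA]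

theorem setLIntegral_exp_lawShiftPoint [SFinite μ] {X : GenFun H P} (hX : X.IsStandardGaussian)
    (Y : GenFun H μ) {J : Finset ι} (c : J → ℝ) {A : Set T} (hA : MeasurableSet A) :
    ∫⁻ p in Set.univ ×ˢ A, ENNReal.ofReal (Real.exp (∑ j, c j * p.1 j)) ∂(lawShiftPoint b X Y) =
      ENNReal.ofReal (Real.exp (‖∑ j, c j • b j‖ ^ 2 / 2)) *
        ∫⁻ t in A, ENNReal.ofReal (Real.exp (Y.pair (∑ j, c j • b j) t)) ∂μ := by
  set η : H := ∑ j, c j • b j with hη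
  have hpre : (fun p : Ω × T => (X.coords b p.1 + Y.coords b p.2, p.2)) ⁻¹' (Set.univ ×ˢ A) =
      Set.univ ×ˢ A := by
    ext; simp
  rw [lawShiftPoint, setLIntegral_map (MeasurableSet.univ.prod hA) (by fun_prop)
      (measurable_coords_add_coords_prodMk b X Y), hpre, ← Measure.prod_restrict,
    Measure.restrict_univ, ← hX.lintegral_exp, ← lintegral_prod_mul (by fun_prop) (by fun_prop)]
  have h1 : ∀ᵐ p ∂(P.prod (μ.restrict A)), X.pair η p.1 = ∑ j, c j * X.coords b p.1 j :=
    Measure.quasiMeasurePreserving_fst.ae (X.pair_sum_ae Finset.univ c fun j => b j)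
  have h2 : ∀ᵐ p ∂(P.prod (μ.restrict A)), Y.pair η p.2 = ∑ j, c j * Y.coords b p.2 j :=
    Measure.quasiMeasurePreserving_snd.ae
      (ae_restrict_of_ae (Y.pair_sum_ae Finset.univ c fun j => b j))
  refine lintegral_congr_ae ?_
  filter_upwards [h1, h2] with p hp1 hp2
  rw [hp1, hp2, ← ENNReal.ofReal_mul (Real.exp_pos _).le, ← Real.exp_add,
    ← Finset.sum_add_distrib]
  simp [mul_add]

/-- Both laws agree over a set of finite measure on which finitely many coordinates of `Y` are
bounded; the bound makes the Laplace transforms finite. -/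
theorem map_restrict_lawPeyriere_eq_of_bounded [SFinite μ] {X : GenFun H P}
    (hX : X.IsStandardGaussian) {Y : GenFun H μ} {M : Kernel (ι → ℝ) T} (hM : IsGMC b X Y M)
    (hE : expectationMeasure b X M = μ) (J : Finset ι) {A : Set T} (hA : MeasurableSet A)
    (hAμ : μ A ≠ ∞) {C : ℝ} (hC : ∀ t ∈ A, ∀ j ∈ J, |Y.coords b t j| ≤ C) :
    ((lawPeyriere b X M).restrict (Set.univ ×ˢ A)).map (fun p => J.restrict p.1) =
      ((lawShiftPoint b X Y).restrict (Set.univ ×ˢ A)).map fun p => J.restrict p.1 := by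
  have : IsFiniteMeasure ((lawPeyriere b X M).restrict (Set.univ ×ˢ A)) := by
    rw [isFiniteMeasure_restrict, lawPeyriere_univ_prod b X hM.finite hA, hE]
    exact hAμ
  have : IsFiniteMeasure ((lawShiftPoint b X Y).restrict (Set.univ ×ˢ A)) := by
    rw [isFiniteMeasure_restrict, lawShiftPoint_univ_prod b X Y hA]
    exact hAμ
  have hr : Measurable fun p : (ι → ℝ) × T => J.restrict p.1 := by fun_prop
  refine ext_of_lintegral_exp_pi (fun c => ?_) fun c => ?_
  · rw [lintegral_map (by fun_prop) hr]
    refine ((setLIntegral_exp_lawPeyriere b hX hM hE c hA).trans_ne ?_)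
    refine ENNReal.mul_ne_top ENNReal.ofReal_ne_top (ne_top_of_le_ne_top
      (b := ENNReal.ofReal (Real.exp (∑ j, |c j| * C)) * μ A)
      (ENNReal.mul_ne_top ENNReal.ofReal_ne_top hAμ) ?_)
    rw [← setLIntegral_const]
    refine lintegral_mono_ae ?_
    filter_upwards [ae_restrict_mem hA,
      ae_restrict_of_ae (Y.pair_sum_ae Finset.univ c fun j => b j)] with t ht h
    rw [h]
    refine ENNReal.ofReal_le_ofReal (Real.exp_le_exp.2 (Finset.sum_le_sum fun j _ => ?_))
    refine (le_abs_self _).trans ?_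
    rw [abs_mul]
    exact mul_le_mul_of_nonneg_left (hC t ht j j.2) (abs_nonneg _)
  · rw [lintegral_map (by fun_prop) hr, lintegral_map (by fun_prop) hr]
    exact (setLIntegral_exp_lawPeyriere b hX hM hE c hA).trans
      (setLIntegral_exp_lawShiftPoint b hX Y c hA).symm

/-- The bound on the coordinates of `Y` is removed by exhausting `A` by the sets on which the
coordinates indexed by `J` are at most `n`. -/
theorem map_restrict_lawPeyriere_eq [SFinite μ] {X : GenFun H P}
    (hX : X.IsStandardGaussian) {Y : GenFun H μ} {M : Kernel (ι → ℝ) T} (hM : IsGMC b X Y M)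
    (hE : expectationMeasure b X M = μ) (J : Finset ι) {A : Set T} (hA : MeasurableSet A)
    (hAμ : μ A ≠ ∞) :
    ((lawPeyriere b X M).restrict (Set.univ ×ˢ A)).map (fun p => J.restrict p.1) =
      ((lawShiftPoint b X Y).restrict (Set.univ ×ˢ A)).map fun p => J.restrict p.1 := by
  have hr : Measurable fun p : (ι → ℝ) × T => J.restrict p.1 := by fun_prop
  let An : ℕ → Set T := fun n => A ∩ ⋂ j ∈ J, {t | |Y.coords b t j| ≤ n}
  have hAn : ∀ n, MeasurableSet (An n) := fun n =>
    hA.inter (Finset.measurableSet_biInter J fun j _ => measurableSet_le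
      (((measurable_pi_apply j).comp (Y.measurable_coords b)).abs) measurable_const)
  have hmono : Monotone An := fun m n hmn => Set.inter_subset_inter_right _
    (Set.iInter₂_mono fun j _ t (ht : |Y.coords b t j| ≤ m) =>
      ht.trans (Nat.cast_le.2 hmn : (m : ℝ) ≤ n))
  have hU : ⋃ n, An n = A := by
    refine subset_antisymm (Set.iUnion_subset fun n => Set.inter_subset_left) fun t ht => ?_
    obtain ⟨n, hn⟩ := exists_nat_ge (∑ j ∈ J, |Y.coords b t j|)
    refine Set.mem_iUnion.2 ⟨n, ht, Set.mem_iInter₂.2 fun j hj => le_trans ?_ hn⟩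
    exact Finset.single_le_sum (f := fun j => |Y.coords b t j|) (fun _ _ => abs_nonneg _) hj
  have key : ∀ (m : Measure ((ι → ℝ) × T)) (S : Set (J → ℝ)), MeasurableSet S →
      (m.restrict (Set.univ ×ˢ A)).map (fun p => J.restrict p.1) S =
        ⨆ n, (m.restrict (Set.univ ×ˢ An n)).map (fun p => J.restrict p.1) S := by
    intro m S hS
    simp_rw [Measure.map_apply hr hS, Measure.restrict_apply (hr hS)]
    rw [← hU, Set.prod_iUnion, Set.inter_iUnion]
    exact Monotone.measure_iUnion fun i j hij =>
      Set.inter_subset_inter_right _ (Set.prod_mono_right (hmono hij))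
  ext S hS
  rw [key _ S hS, key _ S hS]
  refine iSup_congr fun n => ?_
  rw [map_restrict_lawPeyriere_eq_of_bounded b hX hM hE J (hAn n)
    (measure_ne_top_of_subset Set.inter_subset_left hAμ) (C := n)
    fun t ht j hj => Set.mem_iInter₂.1 ht.2 j hj]

theorem lawPeyriere_eq_lawShiftPoint [SigmaFinite μ] {X : GenFun H P}
    (hX : X.IsStandardGaussian) {Y : GenFun H μ} {M : Kernel (ι → ℝ) T} (hM : IsGMC b X Y M)
    (hE : expectationMeasure b X M = μ) :
    lawPeyriere b X M = lawShiftPoint b X Y := by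
  have hfin : ∀ A, MeasurableSet A → μ A ≠ ∞ →
      IsFiniteMeasure ((lawPeyriere b X M).restrict (Set.univ ×ˢ A)) := fun A hA hAμ => by
    rw [isFiniteMeasure_restrict, lawPeyriere_univ_prod b X hM.finite hA, hE]
    exact hAμ
  have hfst : ∀ A, MeasurableSet A → μ A ≠ ∞ →
      ((lawPeyriere b X M).restrict (Set.univ ×ˢ A)).map Prod.fst =
        ((lawShiftPoint b X Y).restrict (Set.univ ×ˢ A)).map Prod.fst := fun A hA hAμ => by
    have := hfin A hA hAμ
    refine ext_of_map_restrict fun J => ?_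
    have hr : Measurable (J.restrict : (ι → ℝ) → (J → ℝ)) := by fun_prop
    rw [Measure.map_map hr measurable_fst, Measure.map_map hr measurable_fst]
    exact map_restrict_lawPeyriere_eq b hX hM hE J hA hAμ
  refine Measure.ext_of_iUnion_eq_univ (s := fun n => Set.univ ×ˢ spanningSets μ n)
    (by rw [← Set.prod_iUnion, iUnion_spanningSets, Set.univ_prod_univ]) fun n => ?_
  have := hfin _ (measurableSet_spanningSets μ n) (measure_spanningSets_lt_top μ n).ne
  refine Measure.ext_prod fun {B A} hB hA => ?_
  have h := congrArg (fun m => m B) (hfst (A ∩ spanningSets μ n)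
    (hA.inter (measurableSet_spanningSets μ n))
    (measure_ne_top_of_subset Set.inter_subset_right (measure_spanningSets_lt_top μ n).ne))
  simp only [Measure.map_apply measurable_fst hB, Measure.restrict_apply (measurable_fst hB)] at h
  have hset : B ×ˢ A ∩ Set.univ ×ˢ spanningSets μ n =
      Prod.fst ⁻¹' B ∩ Set.univ ×ˢ (A ∩ spanningSets μ n) := by
    ext; simp [and_assoc]
  rwa [Measure.restrict_apply (hB.prod hA), Measure.restrict_apply (hB.prod hA), hset]

/-- The law of `X` under the Peyrière measure has density `M(x, T)` with respect to the law of
`X`. -/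
theorem lawPeyriere_map_fst (X : GenFun H P) {M : Kernel (ι → ℝ) T}
    (hM : ∀ x, IsFiniteMeasure (M x)) :
    (lawPeyriere b X M).map Prod.fst = (lawX b X).withDensity fun x => M x Set.univ := by
  have hMm : Measurable fun x => M x Set.univ := M.measurable_coe MeasurableSet.univ
  ext B hB
  rw [Measure.map_apply measurable_fst hB, ← Set.prod_univ,
    lawPeyriere_apply_prod b X hM hB MeasurableSet.univ, withDensity_apply _ hB, lawX,
    setLIntegral_map hB hMm (X.measurable_coords b)]

theorem isRandomizedShift_and_sigmaFinite [SigmaFinite μ] {X : GenFun H P}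
    (hX : X.IsStandardGaussian) {Y : GenFun H μ} {M : Kernel (ι → ℝ) T} (hM : IsGMC b X Y M)
    (hE : expectationMeasure b X M = μ) :
    IsRandomizedShift b X Y ∧ SigmaFinite (lawShift b X Y) := by
  have hfin := hM.finite
  have h : lawShift b X Y = (lawX b X).withDensity fun x => ((M x Set.univ).toNNReal : ℝ≥0∞) := by
    rw [← lawShiftPoint_map_fst, ← lawPeyriere_eq_lawShiftPoint b hX hM hE,
      lawPeyriere_map_fst b X hM.finite]
    congr 1
    ext x
    have := hfin x
    rw [ENNReal.coe_toNNReal (measure_ne_top _ _)]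
  have : IsProbabilityMeasure (lawX b X) :=
    Measure.isProbabilityMeasure_map (X.measurable_coords b).aemeasurable
  rw [IsRandomizedShift, h]
  exact ⟨withDensity_absolutelyContinuous _ _, SigmaFinite.withDensity _⟩

end

/-! ### Disintegration over a reference measure -/

/-- Disintegration over a reference measure: the density of the first marginal is absorbed into
the kernel, whose values are therefore finite measures rather than probability measures. -/
theorem exists_kernel_compProd_eq {α T : Type*} [MeasurableSpace α] [MeasurableSpace T]
    [StandardBorelSpace T] {γ : Measure α} [SigmaFinite γ] (ν : Measure (α × T))
    [SigmaFinite ν.fst] (hac : ν.fst ≪ γ) :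
    ∃ M : Kernel α T, (∀ x, IsFiniteMeasure (M x)) ∧ γ ⊗ₘ M = ν := by
  rcases isEmpty_or_nonempty T with hT | hT
  · exact ⟨0, fun x => by rw [zero_apply]; infer_instance,
      Measure.ext fun s _ => by rw [Set.eq_empty_of_isEmpty s]; simp⟩
  -- An integrable positive weight reduces to the disintegration of a finite measure.
  obtain ⟨g, hg0, hgm, hg⟩ := exists_pos_lintegral_lt_of_sigmaFinite ν.fst one_ne_zero
  have hgm' : Measurable fun x => (g x : ℝ≥0∞) := hgm.coe_nnreal_ennreal
  set ν' : Measure (α × T) := ν.withDensity fun p => (g p.1 : ℝ≥0∞) with hν'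
  have hgm₁ : Measurable fun p : α × T => (g p.1 : ℝ≥0∞) := hgm'.comp measurable_fst
  have : IsFiniteMeasure ν' := by
    refine isFiniteMeasure_withDensity ?_
    rw [Measure.fst, lintegral_map hgm' measurable_fst] at hg
    exact (hg.trans ENNReal.one_lt_top).ne
  have hfst : ν'.fst = ν.fst.withDensity fun x => (g x : ℝ≥0∞) := by
    ext s hs
    rw [Measure.fst_apply hs, hν', withDensity_apply _ (measurable_fst hs), withDensity_apply _ hs,
      Measure.fst, setLIntegral_map hs hgm' measurable_fst]
  set D : α → ℝ≥0 := fun x => (ν.fst.rnDeriv γ x).toNNReal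
  have hDm : Measurable D := (Measure.measurable_rnDeriv _ _).ennreal_toNNReal
  have hDm' : Measurable fun x => (D x : ℝ≥0∞) := hDm.coe_nnreal_ennreal
  have hD : γ.withDensity (fun x => (D x : ℝ≥0∞)) = ν.fst := by
    conv_rhs => rw [← Measure.withDensity_rnDeriv_eq _ _ hac]
    refine withDensity_congr_ae ?_
    filter_upwards [Measure.rnDeriv_lt_top ν.fst γ] with x hx
    exact ENNReal.coe_toNNReal hx.ne
  have hM : ∀ x, ν'.condKernel.withDensity (fun x _ => (D x : ℝ≥0∞)) x =
      (D x : ℝ≥0∞) • ν'.condKernel x := fun x => by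
    rw [Kernel.withDensity_apply _ (by fun_prop), withDensity_const]
  have hMfin : ∀ x, IsFiniteMeasure
      (ν'.condKernel.withDensity (fun x _ => (D x : ℝ≥0∞)) x) := fun x => by
    rw [hM x]
    exact Measure.smul_finite _ ENNReal.coe_ne_top
  refine ⟨ν'.condKernel.withDensity fun x _ => (D x : ℝ≥0∞), hMfin, ?_⟩
  have := isSFiniteKernel_of_forall_finite _ hMfin
  refine Measure.ext_of_lintegral _ fun f hf => ?_
  have hκ : Measurable fun x => ∫⁻ y, f (x, y) ∂(ν'.condKernel x) :=
    hf.lintegral_kernel_prod_right'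
  have hinv : ∀ x, (g x : ℝ≥0∞) * (g x : ℝ≥0∞)⁻¹ = 1 := fun x =>
    ENNReal.mul_inv_cancel (by simpa using (hg0 x).ne') ENNReal.coe_ne_top
  calc
    _ = ∫⁻ x, D x * ∫⁻ y, f (x, y) ∂(ν'.condKernel x) ∂γ := by
      rw [Measure.lintegral_compProd hf]
      simp_rw [hM, lintegral_smul_measure, smul_eq_mul]
    _ = ∫⁻ x, ∫⁻ y, f (x, y) ∂(ν'.condKernel x) ∂ν.fst := by
      rw [← hD, lintegral_withDensity_eq_lintegral_mul _ hDm' hκ]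
      rfl
    _ = ∫⁻ x, g x * ((g x : ℝ≥0∞)⁻¹ * ∫⁻ y, f (x, y) ∂(ν'.condKernel x)) ∂ν.fst := by
      simp_rw [← mul_assoc, hinv, one_mul]
    _ = ∫⁻ x, (g x : ℝ≥0∞)⁻¹ * ∫⁻ y, f (x, y) ∂(ν'.condKernel x) ∂ν'.fst := by
      rw [hfst]
      exact (lintegral_withDensity_eq_lintegral_mul _ hgm' (hgm'.inv.mul hκ)).symm
    _ = ∫⁻ p, (g p.1 : ℝ≥0∞)⁻¹ * f p ∂ν' := by
      conv_rhs => rw [← ν'.disintegrate ν'.condKernel]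
      rw [Measure.lintegral_compProd (by fun_prop)]
      refine lintegral_congr fun x => ?_
      exact (lintegral_const_mul _ (by fun_prop)).symm
    _ = ∫⁻ p, f p ∂ν := by
      rw [hν', lintegral_withDensity_eq_lintegral_mul _ hgm₁ (by fun_prop)]
      refine lintegral_congr fun p => ?_
      simp only [Pi.mul_apply]
      rw [← mul_assoc, hinv, one_mul]

/-! ### Construction of the chaos of a randomized shift -/

section

variable {H : Type*} [NormedAddCommGroup H] [InnerProductSpace ℝ H]
  {ι : Type*} (b : HilbertBasis ι ℝ H)
  {Ω : Type*} [MeasurableSpace Ω] {P : Measure Ω} [IsProbabilityMeasure P]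
  {T : Type*} [MeasurableSpace T] {μ : Measure T}

/-- Along suitable finite partial sums of the expansion of `ξ`, the pairings with `X` and with `Y`
converge almost everywhere at the same time. -/
theorem GenFun.exists_seq_tendsto_ae [Countable ι] [SFinite μ] (X : GenFun H P) (Y : GenFun H μ)
    (ξ : H) :
    ∃ s : ℕ → Finset ι,
      (∀ᵐ ω ∂P, Tendsto (fun n => ∑ i ∈ s n, b.repr ξ i * X.coords b ω i) atTop
        (𝓝 (X.pair ξ ω))) ∧
      ∀ᵐ t ∂μ, Tendsto (fun n => ∑ i ∈ s n, b.repr ξ i * Y.coords b t i) atTop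
        (𝓝 (Y.pair ξ t)) := by
  -- Successive subsequences: first for `X`, then for `Y` along the one chosen for `X`.
  obtain ⟨s, hs⟩ := exists_seq_tendsto (atTop : Filter (Finset ι))
  have hξ : Tendsto (fun n => ∑ i ∈ s n, b.repr ξ i • b i) atTop (𝓝 ξ) :=
    (b.hasSum_repr ξ).comp hs
  obtain ⟨k, hk, hX⟩ :=
    TendstoInMeasure.exists_seq_tendsto_ae fun ε hε => (X.continuous_pair ξ ε hε).comp hξ
  obtain ⟨l, hl, hY⟩ := TendstoInMeasure.exists_seq_tendsto_ae fun ε hε =>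
    (Y.continuous_pair ξ ε hε).comp (hξ.comp hk.tendsto_atTop)
  rw [ae_toFinite] at hX hY
  refine ⟨fun n => s (k (l n)), ?_, ?_⟩
  · filter_upwards [hX, ae_all_iff.2 fun n =>
      X.pair_sum_ae (s (k (l n))) (fun i => b.repr ξ i) b] with ω h1 h2
    exact (h1.comp hl.tendsto_atTop).congr h2
  · filter_upwards [hY, ae_all_iff.2 fun n =>
      Y.pair_sum_ae (s (k (l n))) (fun i => b.repr ξ i) b] with t h1 h2
    exact h1.congr h2

/-- The Cameron–Martin density of `ξ` as a measurable function on all of `ℝ^ι`. Although the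
pairing with `ξ` is not a function of finitely many coordinates, one and the same function
evaluates correctly at `X` and at `X + Y`. -/
theorem GenFun.exists_measurable_exp_pair [Countable ι] [SFinite μ] (X : GenFun H P)
    (Y : GenFun H μ) (ξ : H) (a : ℝ) :
    ∃ w : (ι → ℝ) → ℝ≥0∞, Measurable w ∧
      (∀ᵐ ω ∂P, w (X.coords b ω) = ENNReal.ofReal (Real.exp (X.pair ξ ω - a))) ∧
      ∀ᵐ p ∂(P.prod μ), w (X.coords b p.1 + Y.coords b p.2) =
        ENNReal.ofReal (Real.exp (X.pair ξ p.1 - a)) *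
          ENNReal.ofReal (Real.exp (Y.pair ξ p.2)) := by
  obtain ⟨s, hX, hY⟩ := GenFun.exists_seq_tendsto_ae b X Y ξ
  have hlim : ∀ {u : ℕ → ℝ} {r : ℝ}, Tendsto u atTop (𝓝 r) →
      limsup (fun n => ENNReal.ofReal (Real.exp (u n - a))) atTop =
        ENNReal.ofReal (Real.exp (r - a)) := fun h =>
    (ENNReal.tendsto_ofReal ((Real.continuous_exp.tendsto _).comp (h.sub_const a))).limsup_eq
  refine ⟨fun x => limsup (fun n =>
    ENNReal.ofReal (Real.exp (∑ i ∈ s n, b.repr ξ i * x i - a))) atTop,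
    Measurable.limsup fun n => by fun_prop, ?_, ?_⟩
  · filter_upwards [hX] with ω h using hlim h
  · filter_upwards [Measure.quasiMeasurePreserving_fst.ae hX,
      Measure.quasiMeasurePreserving_snd.ae hY] with p h1 h2
    rw [← ENNReal.ofReal_mul (Real.exp_pos _).le, ← Real.exp_add, sub_add_eq_add_sub]
    refine hlim ((h1.add h2).congr fun n => ?_)
    rw [← Finset.sum_add_distrib]
    simp [mul_add]

theorem lintegral_lawShiftPoint [SFinite μ] (X : GenFun H P) (Y : GenFun H μ)
    {F : (ι → ℝ) × T → ℝ≥0∞} (hF : Measurable F) :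
    ∫⁻ p, F p ∂(lawShiftPoint b X Y) =
      ∫⁻ p, F (X.coords b p.1 + Y.coords b p.2, p.2) ∂(P.prod μ) :=
  lintegral_map hF (measurable_coords_add_coords_prodMk b X Y)

/-- Two kernels, one with finite values, agree almost everywhere as soon as they agree almost
everywhere on each fixed set. -/
theorem ae_eq_of_forall_ae_apply_eq {α T : Type*} [MeasurableSpace α] [MeasurableSpace T]
    [MeasurableSpace.CountablyGenerated T] {γ : Measure α} {κ η : α → Measure T}
    (hκ : ∀ x, IsFiniteMeasure (κ x)) (h : ∀ A, MeasurableSet A → ∀ᵐ x ∂γ, κ x A = η x A) :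
    ∀ᵐ x ∂γ, κ x = η x := by
  let C : Set (Set T) := generateSetAlgebra (MeasurableSpace.countableGeneratingSet T)
  have hC : C.Countable :=
    countable_generateSetAlgebra (MeasurableSpace.countable_countableGeneratingSet (α := T))
  have hgen : ‹MeasurableSpace T› = MeasurableSpace.generateFrom C := by
    rw [generateFrom_generateSetAlgebra_eq, MeasurableSpace.generateFrom_countableGeneratingSet]
  -- A countable generating algebra allows all null sets to be collected.
  have hall : ∀ᵐ x ∂γ, ∀ A ∈ C, κ x A = η x A := (ae_ball_iff hC).2 fun A hA =>
    h A (by rw [hgen]; exact MeasurableSpace.measurableSet_generateFrom hA)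
  filter_upwards [hall, h _ MeasurableSet.univ] with x hx hu
  have := hκ x
  exact ext_of_generate_finite C hgen
    isSetAlgebra_generateSetAlgebra.isSetRing.isSetSemiring.isPiSystem hx hu

/-- A kernel that disintegrates the law of `(X + Y(t), t)` over the law of `X` transforms under
Cameron–Martin shifts as a chaos does. -/
theorem shift_of_compProd_eq_lawShiftPoint [Countable ι] [MeasurableSpace.CountablyGenerated T]
    [SFinite μ] {X : GenFun H P} (hX : X.IsStandardGaussian) (Y : GenFun H μ)
    {M : Kernel (ι → ℝ) T} (hM : ∀ x, IsFiniteMeasure (M x))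
    (hν : lawX b X ⊗ₘ M = lawShiftPoint b X Y) (ξ : H) :
    ∀ᵐ ω ∂P, M (X.coords b ω + vecCoords b ξ) =
      (M (X.coords b ω)).withDensity fun t => ENNReal.ofReal (Real.exp (Y.pair ξ t)) := by
  have hXm := X.measurable_coords b
  have := isSFiniteKernel_of_forall_finite M hM
  have : IsProbabilityMeasure (lawX b X) :=
    Measure.isProbabilityMeasure_map hXm.aemeasurable
  set v := vecCoords b ξ
  set e : T → ℝ≥0∞ := fun t => ENNReal.ofReal (Real.exp (Y.pair ξ t))
  have hem : Measurable e := by fun_prop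
  obtain ⟨w, hwm, hwX, hwY⟩ := GenFun.exists_measurable_exp_pair b X Y ξ (‖ξ‖ ^ 2 / 2)
  suffices h : ∀ᵐ x ∂(lawX b X), M (x + v) = (M x).withDensity e from
    ae_of_ae_map hXm.aemeasurable h
  refine ae_eq_of_forall_ae_apply_eq (fun x => hM _) fun A hA => ?_
  have hMA : Measurable fun x => M x A := M.measurable_coe hA
  have hMe : Measurable fun x => (M x).withDensity e A := by
    simp_rw [withDensity_apply _ hA, ← lintegral_indicator hA]
    exact Measurable.lintegral_kernel (hem.indicator hA)
  refine ae_eq_of_forall_setLIntegral_eq_of_sigmaFinite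
    (hMA.comp (measurable_id.add_const v)) hMe fun B hB _ => ?_
  set I : (ι → ℝ) → ℝ≥0∞ := B.indicator 1 with hI
  have hIm : Measurable I := measurable_one.indicator hB
  have hIs : Measurable fun x => I (x - v) := hIm.comp (measurable_id.sub_const v)
  set a : T → ℝ≥0∞ := A.indicator 1 with ha
  have ham : Measurable a := measurable_one.indicator hA
  have hset : ∀ {f : (ι → ℝ) → ℝ≥0∞}, Measurable f →
      ∫⁻ x in B, f x ∂(lawX b X) = ∫⁻ x, I x * f x ∂(lawX b X) := fun {f} _ => by
    rw [← lintegral_indicator hB]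
    refine lintegral_congr fun x => ?_
    by_cases hx : x ∈ B <;> simp [hI, hx]
  have hdis : ∀ {F : (ι → ℝ) → ℝ≥0∞} {f : T → ℝ≥0∞}, Measurable F → Measurable f →
      ∫⁻ x, F x * ∫⁻ t, f t ∂(M x) ∂(lawX b X) =
        ∫⁻ p, F (X.coords b p.1 + Y.coords b p.2) * f p.2 ∂(P.prod μ) := fun {F f} hF hf => by
    have hFf : Measurable fun p : (ι → ℝ) × T => F p.1 * f p.2 :=
      (hF.comp measurable_fst).mul (hf.comp measurable_snd)
    rw [← lintegral_lawShiftPoint b X Y hFf, ← hν, Measure.lintegral_compProd hFf]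
    exact lintegral_congr fun x => (lintegral_const_mul _ hf).symm
  have hia : ∀ x, M x A = ∫⁻ t, a t ∂(M x) := fun x => (lintegral_indicator_one hA).symm
  calc
    _ = ∫⁻ x, I x * M (x + v) A ∂(lawX b X) := hset (hMA.comp (measurable_id.add_const v))
    -- The integrand becomes a function of `X + ξ`, to which Cameron–Martin applies.
    _ = ∫⁻ ω, I (X.coords b ω + v - v) * M (X.coords b ω + v) A ∂P := by
      rw [lawX, lintegral_map (by fun_prop) hXm]
      simp only [add_sub_cancel_right]
    _ = ∫⁻ ω, w (X.coords b ω) * (I (X.coords b ω - v) * M (X.coords b ω) A) ∂P := by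
      rw [hX.lintegral_comp_add b ξ (G := fun x => I (x - v) * M x A) (hIs.mul hMA)]
      refine lintegral_congr_ae ?_
      filter_upwards [hwX] with ω hω
      rw [hω]
    _ = ∫⁻ x, w x * I (x - v) * ∫⁻ t, a t ∂(M x) ∂(lawX b X) := by
      simp_rw [← hia, mul_assoc]
      rw [lawX, lintegral_map (by fun_prop) hXm]
    _ = ∫⁻ p, ENNReal.ofReal (Real.exp (X.pair ξ p.1 - ‖ξ‖ ^ 2 / 2)) *
          I (X.coords b p.1 + Y.coords b p.2 - v) * (a p.2 * e p.2) ∂(P.prod μ) := by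
      refine (hdis (hwm.mul hIs) ham).trans ?_
      refine lintegral_congr_ae ?_
      filter_upwards [hwY] with p hp
      simp only [Pi.mul_apply]
      rw [hp]
      ring
    -- For each fixed `t`, Cameron–Martin undoes the shift and leaves the factor `exp ⟨Y(t), ξ⟩`.
    _ = ∫⁻ p, I (X.coords b p.1 + Y.coords b p.2) * (a p.2 * e p.2) ∂(P.prod μ) := by
      have hXY := measurable_coords_add_coords b X Y
      have h2 : Measurable fun p : Ω × T => a p.2 * e p.2 := (ham.mul hem).comp measurable_snd
      have h1 : Measurable fun p : Ω × T =>
          ENNReal.ofReal (Real.exp (X.pair ξ p.1 - ‖ξ‖ ^ 2 / 2)) *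
          I (X.coords b p.1 + Y.coords b p.2 - v) * (a p.2 * e p.2) :=
        (Measurable.mul (by fun_prop) (hIs.comp hXY)).mul h2
      have h3 : Measurable fun p : Ω × T =>
          I (X.coords b p.1 + Y.coords b p.2) * (a p.2 * e p.2) := (hIm.comp hXY).mul h2
      rw [lintegral_prod_symm _ h1.aemeasurable,
        lintegral_prod_symm _ h3.aemeasurable]
      refine lintegral_congr fun t => ?_
      have hIt : Measurable fun x => I (x + Y.coords b t - v) :=
        hIs.comp (measurable_id.add_const _)
      have hIt₁ : Measurable fun ω => I (X.coords b ω + Y.coords b t) :=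
        hIm.comp (hXm.add_const _)
      have hIt₂ : Measurable fun ω => ENNReal.ofReal (Real.exp (X.pair ξ ω - ‖ξ‖ ^ 2 / 2)) *
          I (X.coords b ω + Y.coords b t - v) := Measurable.mul (by fun_prop) (hIt.comp hXm)
      simp only
      rw [lintegral_mul_const _ hIt₂, lintegral_mul_const _ hIt₁, ← hX.lintegral_comp_add b ξ hIt]
      simp only [add_right_comm _ (vecCoords b ξ), v, add_sub_cancel_right]
    _ = ∫⁻ x, I x * ∫⁻ t, a t * e t ∂(M x) ∂(lawX b X) := (hdis hIm (ham.mul hem)).symm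
    _ = _ := by
      rw [hset hMe]
      refine lintegral_congr fun x => ?_
      rw [withDensity_apply _ hA, ← lintegral_indicator hA]
      congr 2
      ext t
      by_cases ht : t ∈ A <;> simp [ha, ht]

theorem exists_isSubcriticalGMC [Countable ι] [StandardBorelSpace T] [SigmaFinite μ]
    {X : GenFun H P} (hX : X.IsStandardGaussian) {Y : GenFun H μ}
    (hY : IsRandomizedShift b X Y) (hσ : SigmaFinite (lawShift b X Y)) :
    ∃ M : Kernel (ι → ℝ) T, IsSubcriticalGMC b X Y M ∧ expectationMeasure b X M = μ := by
  have : IsProbabilityMeasure (lawX b X) :=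
    Measure.isProbabilityMeasure_map (X.measurable_coords b).aemeasurable
  have hfst : (lawShiftPoint b X Y).fst = lawShift b X Y := lawShiftPoint_map_fst b X Y
  have : SigmaFinite (lawShiftPoint b X Y).fst := by rwa [hfst]
  obtain ⟨M, hM, hν⟩ := exists_kernel_compProd_eq (γ := lawX b X) (lawShiftPoint b X Y)
    (by rw [hfst]; exact hY)
  have := isSFiniteKernel_of_forall_finite M hM
  have hE : expectationMeasure b X M = μ := by
    ext A hA
    rw [← lawShiftPoint_univ_prod b X Y hA, ← hν,
      Measure.compProd_apply_prod MeasurableSet.univ hA, Measure.restrict_univ,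
      expectationMeasure_apply b X M hA, lawX,
      lintegral_map (M.measurable_coe hA) (X.measurable_coords b)]
  refine ⟨M, ⟨⟨hM, ?_, shift_of_compProd_eq_lawShiftPoint b hX Y hM hν⟩, ?_⟩, hE⟩
  · rw [hE]
  · rwa [hE]

end

theorem mainTheorem2
    {H : Type*} [NormedAddCommGroup H] [InnerProductSpace ℝ H] [CompleteSpace H]
    {ι : Type*} [Countable ι] (b : HilbertBasis ι ℝ H)
    {Ω : Type*} [MeasurableSpace Ω] [StandardBorelSpace Ω]
    (P : Measure Ω) [IsProbabilityMeasure P]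
    {T : Type*} [MeasurableSpace T] [StandardBorelSpace T]
    (μ : Measure T) [SigmaFinite μ]
    (X : GenFun H P) (hX : X.IsStandardGaussian) (Y : GenFun H μ) :
    (IsFiniteMeasure μ →
      ((∃ M : Kernel (ι → ℝ) T, IsSubcriticalGMC b X Y M ∧ expectationMeasure b X M = μ) ↔
        IsRandomizedShift b X Y)) ∧
    ((∃ M : Kernel (ι → ℝ) T, IsSubcriticalGMC b X Y M ∧ expectationMeasure b X M = μ) ↔
      IsRandomizedShift b X Y ∧ SigmaFinite (lawShift b X Y)) ∧
    ∀ M : Kernel (ι → ℝ) T, IsSubcriticalGMC b X Y M → expectationMeasure b X M = μ →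
      lawPeyriere b X M = lawShiftPoint b X Y := by
  refine ⟨fun _ => ⟨?_, fun hY => ?_⟩, ⟨?_, fun h => exists_isSubcriticalGMC b hX h.1 h.2⟩,
    fun M hM hE => lawPeyriere_eq_lawShiftPoint b hX hM.toIsGMC hE⟩
  · rintro ⟨M, hM, hE⟩
    exact (isRandomizedShift_and_sigmaFinite b hX hM.toIsGMC hE).1
  · have : IsFiniteMeasure (lawShift b X Y) := by
      rw [lawShift]
      infer_instance
    exact exists_isSubcriticalGMC b hX hY inferInstance
  · rintro ⟨M, hM, hE⟩
    exact isRandomizedShift_and_sigmaFinite b hX hM.toIsGMC hE
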